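/- Let $\mu$ and $\lambda$ be cardinals such that $2^{\aleph_0} < \mu^+ < \lambda = \operatorname{cf}(\lambda) < \mu^{\aleph_0}$, where $\mu^+$ is the successor cardinal of $\mu$. Let $\mathfrak K^{\mathrm{rtf}}_\lambda$ be the class of abelian groups of cardinality $\lambda$ that are torsion-free and reduced, where reduced means that $(\mathbb Q,+)$ does not embed into the group. Then $\mathfrak K^{\mathrm{rtf}}_\lambda$ has no universal member under arbitrary (not necessarily pure) embeddings: there is no $G \in \mathfrak K^{\mathrm{rtf}}_\lambda$ such that for every $H \in \mathfrak K^{\mathrm{rtf}}_\lambda$ there is an injective group homomorphism $H \to G$. -/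

import Mathlib

universe u

open scoped Cardinal

/-- An abelian group is reduced if `(ℚ, +)` cannot be embedded into it. -/
def AddCommGroup.IsReducedGroup (G : Type u) [AddCommGroup G] : Prop :=
  ¬ ∃ f : ℚ →+ G, Function.Injective f

/-- `G` is a reduced torsion-free abelian group of cardinality `lam`. -/
structure IsReducedTorsionFreeOfCard (lam : Cardinal.{u}) (G : Type u) [AddCommGroup G] :
    Prop where
  torsionFree : IsAddTorsionFree G
  reduced : AddCommGroup.IsReducedGroup G
  card_eq : #G = lam

/-- `G` is a universal member of the class of reduced torsion-free abelian groups of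
cardinality `lam`: it belongs to the class, and every member of the class embeds into it
by an injective homomorphism, whose image need not be pure. -/
structure IsUniversalReducedTorsionFree (lam : Cardinal.{u}) (G : Type u) [AddCommGroup G] :
    Prop where
  mem : IsReducedTorsionFreeOfCard lam G
  embeds : ∀ (H : Type u) [AddCommGroup H], IsReducedTorsionFreeOfCard lam H →
    ∃ f : H →+ G, Function.Injective f

/-! Suppose `G` is universal, and let `r` enumerate it in type λ. Club guessing, available because
μ⁺ < λ, gives λ many sequences `C j` of length μ in λ such that every club contains some increasing
`C j`. Say that a triple `(j, y, b)`, with `y` in `G` and `b` a bit sequence, decodes a sequence `η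
: ℕ → μ` if `η n` is the last index `i` for which `y` has no approximation of precision `n` among
the elements of rank below `C j i`. There are only λ triples but more than λ increasing sequences,
so some increasing `η` is decoded by none (`exists_strictMono_forall_not_decodes`). A group `H` is
then built from this `η` so that any embedding into `G` yields a decoding triple.

The generators of `H` are paths of labels and bits: the finite ones, and the infinite ones with
labels `C j ∘ η`. The binary digits of `k` attach the `k`-th prime to a branch of bits, and two
paths are congruent modulo all powers of that prime when they carry the same labels up to their
divergence from the branch. An infinite path is thus approximated by its truncations, for more and
more primes.

The two one-bit extensions of a bit string together exclude no prime. Since `G` is reduced, an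
element approximated off both extensions is determined by its two approximations. If α is closed
under a suitable function, a finite path ending in α therefore cannot have approximations of rank
below α on both sides, and some next bit blocks them (`exists_closure_function`). Guessing a `C j`
of closed points and always taking the blocking bit gives an infinite path whose image decodes `η`
(`exists_decodes`). -/

/-- A linear order whose proper initial segments are small and whose small subsets are strictly
bounded: the order type of a regular uncountable cardinal, when the order is well-founded. -/
structure IsRegularUncountableOrder (K : Type u) [LinearOrder K] : Prop where
  aleph0_lt : ℵ₀ < #K
  exists_gt : ∀ s : Set K, #s < #K → ∃ b, ∀ a ∈ s, a < b
  mk_Iio_lt : ∀ a : K, #(Set.Iio a) < #K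

theorem isRegularUncountableOrder_ord_toType {c : Cardinal.{u}} (hc : c.IsRegular)
    (h : ℵ₀ < c) : IsRegularUncountableOrder c.ord.ToType where
  aleph0_lt := by simpa using h
  exists_gt s hs := by
    have h1 : ¬ IsCofinal s := by
      intro hcof
      have := Order.cof_le hcof
      rw [Ordinal.cof_toType, hc.cof_ord] at this
      rw [Cardinal.mk_ord_toType] at hs
      exact absurd hs this.not_gt
    simpa [IsCofinal] using h1
  mk_Iio_lt a := by simpa using Cardinal.mk_Iio_lt a

namespace IsRegularUncountableOrder

variable {K : Type u} [LinearOrder K]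

theorem mk_Iic_lt (hK : IsRegularUncountableOrder K) (a : K) : #(Set.Iic a) < #K := by
  have h : (Set.Iic a : Set K) = Set.Iio a ∪ {a} := by ext; simp [le_iff_lt_or_eq]
  rw [h]
  exact (Cardinal.mk_union_le _ _).trans_lt
    (Cardinal.add_lt_of_lt hK.aleph0_lt.le (hK.mk_Iio_lt a)
      (by simpa using Cardinal.one_lt_aleph0.trans hK.aleph0_lt))

theorem exists_gt_range (hK : IsRegularUncountableOrder K) {ι : Type*} (f : ι → K)
    (h : Cardinal.lift.{u} #ι < Cardinal.lift #K) : ∃ b, ∀ i, f i < b := by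
  obtain ⟨b, hb⟩ := hK.exists_gt (Set.range f) (by
    have := (Cardinal.mk_range_le_lift (f := f)).trans_lt h
    simpa using this)
  exact ⟨b, fun i => hb _ ⟨i, rfl⟩⟩

end IsRegularUncountableOrder

/-- Well-founded recursion in which each value depends on the set of earlier values. -/
theorem exists_eq_image_Iio {K : Type*} [LinearOrder K] [WellFoundedLT K] {α : Type*}
    (g : Set α → α) : ∃ e : K → α, ∀ k, e k = g (e '' Set.Iio k) := by
  refine ⟨(wellFounded_lt (α := K)).fix fun k ih => g {x | ∃ (j : K) (h : j < k), ih j h = x},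
    fun k => ?_⟩
  rw [WellFounded.fix_eq]
  congr 1
  ext x
  simp

/-- An antitone family in a well-order is eventually constant. -/
theorem Antitone.exists_forall_ge_eq {K Λ : Type*} [LinearOrder K] [Nonempty K] [LinearOrder Λ]
    [WellFoundedLT Λ] {f : K → Λ} (hf : Antitone f) : ∃ k, ∀ j, k ≤ j → f j = f k := by
  obtain ⟨_, ⟨k, rfl⟩, hk⟩ :=
    (wellFounded_lt (α := Λ)).has_min (Set.range f) (Set.range_nonempty f)
  exact ⟨k, fun j hj => le_antisymm (hf hj) (not_lt.1 (hk _ ⟨j, rfl⟩))⟩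

/-! ### Club guessing -/

section ClubGuessing

variable {Λ : Type u} [ConditionallyCompleteLinearOrderBot Λ]

/-- The points closed under `ψ`. -/
def closurePoints (ψ : Λ → Λ) : Set Λ := {a | ∀ b < a, ψ b < a}

/-- The largest point closed under `ψ` that is at most `a`. -/
noncomputable def closureFloor (ψ : Λ → Λ) (a : Λ) : Λ := sSup {e ∈ closurePoints ψ | e ≤ a}

theorem closurePoints_anti {ψ φ : Λ → Λ} (h : ψ ≤ φ) : closurePoints φ ⊆ closurePoints ψ :=
  fun _ ha b hb => (h b).trans_lt (ha b hb)

theorem closureFloor_le (ψ : Λ → Λ) (a : Λ) : closureFloor ψ a ≤ a :=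
  csSup_le' fun _ h => h.2

theorem le_closureFloor {ψ : Λ → Λ} {e a : Λ} (he : e ∈ closurePoints ψ) (h : e ≤ a) :
    e ≤ closureFloor ψ a :=
  le_csSup ⟨a, fun _ h => h.2⟩ ⟨he, h⟩

theorem closureFloor_mem (ψ : Λ → Λ) (a : Λ) : closureFloor ψ a ∈ closurePoints ψ := by
  intro b hb
  obtain ⟨e, he, hbe⟩ := exists_lt_of_lt_csSup' hb
  exact (he.1 b hbe).trans_le (le_closureFloor he.1 he.2)

theorem closureFloor_anti {ψ φ : Λ → Λ} (h : ψ ≤ φ) (a : Λ) :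
    closureFloor φ a ≤ closureFloor ψ a :=
  le_closureFloor (closurePoints_anti h (closureFloor_mem φ a)) (closureFloor_le φ a)

theorem closureFloor_closureFloor {ψ φ : Λ → Λ} (h : ψ ≤ φ) (a : Λ) :
    closureFloor φ (closureFloor ψ a) = closureFloor φ a :=
  le_antisymm
    (le_closureFloor (closureFloor_mem φ _) ((closureFloor_le φ _).trans (closureFloor_le ψ a)))
    (le_closureFloor (closureFloor_mem φ a) (closureFloor_anti h a))

theorem exists_closurePoints_gt (hΛ : IsRegularUncountableOrder Λ) (ψ : Λ → Λ) (a : Λ) :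
    ∃ e ∈ closurePoints ψ, a < e := by
  have h1 : ∀ b : Λ, ∃ b', b < b' ∧ ∀ x ≤ b, ψ x < b' := by
    intro b
    obtain ⟨u, hu⟩ := hΛ.exists_gt (ψ '' Set.Iic b)
      (Cardinal.mk_image_le.trans_lt (hΛ.mk_Iic_lt b))
    obtain ⟨v, hv⟩ := hΛ.exists_gt {b, u} ((Set.toFinite _).lt_aleph0.trans hΛ.aleph0_lt)
    exact ⟨v, hv b (by simp), fun x hx => (hu _ ⟨x, hx, rfl⟩).trans (hv u (by simp))⟩
  choose s hs hsψ using h1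
  let f : ℕ → Λ := fun n => s^[n] a
  have hf : ∀ n, f (n + 1) = s (f n) := fun n => Function.iterate_succ_apply' s n a
  obtain ⟨b, hb⟩ := hΛ.exists_gt_range f (by simpa using hΛ.aleph0_lt)
  have hbdd : BddAbove (Set.range f) := ⟨b, by rintro _ ⟨n, rfl⟩; exact (hb n).le⟩
  have hle : ∀ n, f n ≤ ⨆ n, f n := fun n => le_ciSup hbdd n
  refine ⟨⨆ n, f n, fun x hx => ?_, ?_⟩
  · obtain ⟨n, hn⟩ := exists_lt_of_lt_ciSup' hx
    calc ψ x < s (f n) := hsψ _ _ hn.le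
      _ = f (n + 1) := (hf n).symm
      _ ≤ _ := hle _
  · calc a < s (f 0) := hs a
      _ = f 1 := (hf 0).symm
      _ ≤ _ := hle _

variable {K : Type u} [LinearOrder K] [WellFoundedLT K]

theorem exists_strictMono_mem (hΛ : IsRegularUncountableOrder Λ) (hK : #K < #Λ) {E : Set Λ}
    (hE : ∀ a, ∃ e ∈ E, a < e) : ∃ e : K → Λ, StrictMono e ∧ ∀ k, e k ∈ E := by
  have h1 : ∀ s : Set Λ, ∃ b ∈ E, #s < #Λ → ∀ a ∈ s, a < b := by
    intro s
    by_cases hs : #s < #Λ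
    · obtain ⟨b, hb⟩ := hΛ.exists_gt s hs
      obtain ⟨e, he, hbe⟩ := hE b
      exact ⟨e, he, fun _ a ha => (hb a ha).trans hbe⟩
    · obtain ⟨e, he, -⟩ := hE ⊥
      exact ⟨e, he, fun h => absurd h hs⟩
  choose g hgE hg using h1
  obtain ⟨e, he⟩ := exists_eq_image_Iio (K := K) g
  refine ⟨e, fun j k hjk => ?_, fun k => he k ▸ hgE _⟩
  rw [he k]
  exact hg _ (Cardinal.mk_image_le.trans_lt ((Cardinal.mk_set_le _).trans_lt hK)) _ ⟨j, hjk, rfl⟩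

variable [WellFoundedLT Λ] {μ : Cardinal.{u}}

/-- Take δ to be the supremum of a `K`-sequence of closed points. Rounding down a cofinal family in
δ leaves it cofinal, so it keeps at least μ values, and μ of them already occur before some `ζ`. The
passage to a proper initial segment is what later permits simultaneous stabilization. -/
theorem exists_le_mk_image_closureFloor (hΛ : IsRegularUncountableOrder Λ)
    (hK : IsRegularUncountableOrder K) (hμ : #K = Order.succ μ) (hKΛ : #K < #Λ) :
    ∃ c : Λ → K → Λ, ∀ ψ : Λ → Λ, ∃ δ ζ, μ ≤ #(closureFloor ψ '' (c δ '' Set.Iio ζ)) := by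
  have hμK : μ < #K := hμ ▸ Order.lt_succ_of_not_isMax (not_isMax μ)
  -- The family depends on δ alone, not on `ψ`; the value `⊥` is junk for δ without a cofinal
  -- `K`-family.
  have hc : ∀ δ : Λ, ∃ c : K → Λ, (∃ e : K → Λ, (∀ k, e k < δ) ∧ ∀ b < δ, ∃ k, b ≤ e k) →
      (∀ k, c k < δ) ∧ ∀ b < δ, ∃ k, b ≤ c k := by
    intro δ
    by_cases h : ∃ e : K → Λ, (∀ k, e k < δ) ∧ ∀ b < δ, ∃ k, b ≤ e k
    · exact ⟨h.choose, fun _ => h.choose_spec⟩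
    · exact ⟨fun _ => ⊥, fun h' => absurd h' h⟩
  choose c hc using hc
  refine ⟨c, fun ψ => ?_⟩
  obtain ⟨e, he, heE⟩ := exists_strictMono_mem (K := K) hΛ hKΛ (exists_closurePoints_gt hΛ ψ)
  obtain ⟨b, hb⟩ := hΛ.exists_gt_range e (by simpa using hKΛ)
  obtain ⟨δ, hδ, hmin⟩ := (wellFounded_lt (α := Λ)).has_min {d | ∀ k, e k < d} ⟨b, hb⟩
  have hcof : ∀ b < δ, ∃ k, b ≤ e k := by
    intro b hb
    by_contra! h
    exact hmin b h hb
  obtain ⟨hcδ, hccof⟩ := hc δ ⟨e, hδ, hcof⟩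
  have hlarge : μ ≤ #(Set.range fun k => closureFloor ψ (c δ k)) := by
    by_contra! hlt
    have h1 : ∀ x : Set.range fun k => closureFloor ψ (c δ k), ∃ k, x.1 ≤ e k := by
      rintro ⟨_, k, rfl⟩
      exact hcof _ ((closureFloor_le ψ _).trans_lt (hcδ k))
    choose k hk using h1
    obtain ⟨m, hm⟩ := hK.exists_gt_range k (by simpa using hlt.trans hμK)
    obtain ⟨j, hj⟩ := hccof (e m) (hδ m)
    exact ((le_closureFloor (heE m) hj).trans (hk ⟨_, j, rfl⟩)).not_gt (he (hm _))
  obtain ⟨p, hp, hpμ⟩ := Cardinal.le_mk_iff_exists_subset.1 hlarge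
  choose k hk using fun x : p => hp x.2
  obtain ⟨ζ, hζ⟩ := hK.exists_gt_range k (by simpa [hpμ] using hμK)
  refine ⟨δ, ζ, hpμ ▸ Cardinal.mk_le_mk_of_subset fun x hx => ?_⟩
  exact ⟨_, ⟨_, hζ ⟨x, hx⟩, rfl⟩, hk ⟨x, hx⟩⟩

/-- Club guessing: some function makes the rounded sets guess all clubs. -/
theorem exists_closureFloor_guessing (hΛ : IsRegularUncountableOrder Λ)
    (hK : IsRegularUncountableOrder K) (hμ : #K = Order.succ μ) (hKΛ : #K < #Λ) :
    ∃ (c : Λ → K → Λ) (ψ : Λ → Λ), ∀ θ : Λ → Λ, ∃ δ ζ,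
      μ ≤ #(closureFloor ψ '' (c δ '' Set.Iio ζ)) ∧
        closureFloor ψ '' (c δ '' Set.Iio ζ) ⊆ closurePoints θ := by
  obtain ⟨c, hc⟩ := exists_le_mk_image_closureFloor hΛ hK hμ hKΛ
  refine ⟨c, ?_⟩
  by_contra! hcon
  choose Θ hΘ using hcon
  -- `Θ ψ` is a club not guessed by `ψ`. Iterating `K` times, each function dominates all earlier
  -- ones and their counterexamples.
  have hbound : ∀ S : Set (Λ → Λ), ∃ φ : Λ → Λ, #S < #Λ → ∀ ψ ∈ S, ψ ≤ φ ∧ Θ ψ ≤ φ := by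
    intro S
    by_cases hS : #S < #Λ
    · have h1 : ∀ a : Λ, ∃ b, ∀ ψ ∈ S, ψ a ≤ b ∧ Θ ψ a ≤ b := by
        intro a
        obtain ⟨b₁, h₁⟩ := hΛ.exists_gt_range (fun ψ : S => ψ.1 a) (by simpa using hS)
        obtain ⟨b₂, h₂⟩ := hΛ.exists_gt_range (fun ψ : S => Θ ψ.1 a) (by simpa using hS)
        exact ⟨max b₁ b₂, fun ψ hψ => ⟨(h₁ ⟨ψ, hψ⟩).le.trans (le_max_left _ _),
          (h₂ ⟨ψ, hψ⟩).le.trans (le_max_right _ _)⟩⟩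
      choose φ hφ using h1
      exact ⟨φ, fun _ ψ hψ => ⟨fun a => (hφ a ψ hψ).1, fun a => (hφ a ψ hψ).2⟩⟩
    · exact ⟨id, fun h => absurd h hS⟩
  choose g hg using hbound
  obtain ⟨Ψ, hΨ⟩ := exists_eq_image_Iio (K := K) g
  have hstep : ∀ j k, j < k → Ψ j ≤ Ψ k ∧ Θ (Ψ j) ≤ Ψ k := by
    intro j k hjk
    rw [hΨ k]
    refine hg _ ?_ _ ⟨j, hjk, rfl⟩
    exact Cardinal.mk_image_le.trans_lt ((Cardinal.mk_set_le _).trans_lt hKΛ)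
  have hmono : Monotone Ψ := fun j k hjk =>
    hjk.eq_or_lt.elim (fun h => h ▸ le_rfl) fun h => (hstep j k h).1
  have hlim : ∀ k, Ψ k ≤ g (Set.range Ψ) := fun k =>
    (hg _ (Cardinal.mk_range_le.trans_lt hKΛ) _ ⟨k, rfl⟩).1
  obtain ⟨δ, ζ, hδ⟩ := hc (g (Set.range Ψ))
  have hKne : Nonempty K := ⟨ζ⟩
  -- Floors descend as the functions grow, so each is eventually constant; the fewer than `#K`
  -- points before `ζ` stabilize by a common stage.
  have hstab : ∀ a, ∃ k, ∀ j, k ≤ j → closureFloor (Ψ j) a = closureFloor (Ψ k) a := fun a =>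
    Antitone.exists_forall_ge_eq fun j k hjk => closureFloor_anti (hmono hjk) a
  choose s hs using hstab
  obtain ⟨k, hk⟩ := hK.exists_gt (s '' (c δ '' Set.Iio ζ)) (Cardinal.mk_image_le.trans_lt
    (Cardinal.mk_image_le.trans_lt (hK.mk_Iio_lt ζ)))
  obtain ⟨k', hk'⟩ := hK.exists_gt {k} ((Set.toFinite _).lt_aleph0.trans hK.aleph0_lt)
  replace hk' := hk' k rfl
  refine hΘ (Ψ k) δ ζ (hδ.trans ?_) ?_
  · have : closureFloor (g (Set.range Ψ)) '' (c δ '' Set.Iio ζ) =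
        closureFloor (g (Set.range Ψ)) '' (closureFloor (Ψ k) '' (c δ '' Set.Iio ζ)) := by
      rw [Set.image_image (closureFloor (g (Set.range Ψ))) (closureFloor (Ψ k))]
      exact Set.image_congr fun a _ => (closureFloor_closureFloor (hlim k) a).symm
    rw [this]
    exact Cardinal.mk_image_le
  -- The stable floor at stage `k` is also the floor at the later stage `k'`, hence closed under `Θ
  -- (Ψ k)`, against the choice of `Θ`.
  · rintro _ ⟨a, ha, rfl⟩
    have h1 := hk _ ⟨a, ha, rfl⟩
    rw [hs a k h1.le, ← hs a k' (h1.trans hk').le]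
    exact closurePoints_anti (hstep k k' hk').2 (closureFloor_mem _ _)

theorem exists_strictMono_of_ord_toType_le {s : Set Λ} (h : μ ≤ #s) :
    ∃ e : μ.ord.ToType → Λ, StrictMono e ∧ ∀ i, e i ∈ s := by
  have h1 : Ordinal.type (α := μ.ord.ToType) (· < ·) ≤ Ordinal.type (α := s) (· < ·) := by
    rw [Ordinal.type_toType, Cardinal.ord_le]
    simpa using h
  obtain ⟨f⟩ := Ordinal.type_le_iff'.1 h1
  exact ⟨fun i => (f i).1, fun i j hij => f.map_rel_iff.2 hij, fun i => (f i).2⟩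

/-- Club guessing along sequences of length `μ`. -/
theorem exists_strictMono_guessing (hΛ : IsRegularUncountableOrder Λ)
    (hK : IsRegularUncountableOrder K) (hμ : #K = Order.succ μ) (hKΛ : #K < #Λ) :
    ∃ C : Λ × K → μ.ord.ToType → Λ, ∀ θ : Λ → Λ, ∃ j, StrictMono (C j) ∧
      ∀ i, C j i ∈ closurePoints θ := by
  obtain ⟨c, ψ, hc⟩ := exists_closureFloor_guessing hΛ hK hμ hKΛ
  have h1 : ∀ j : Λ × K, ∃ e : μ.ord.ToType → Λ,
      μ ≤ #(closureFloor ψ '' (c j.1 '' Set.Iio j.2)) →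
        StrictMono e ∧ ∀ i, e i ∈ closureFloor ψ '' (c j.1 '' Set.Iio j.2) := by
    intro j
    by_cases h : μ ≤ #(closureFloor ψ '' (c j.1 '' Set.Iio j.2))
    · obtain ⟨e, he⟩ := exists_strictMono_of_ord_toType_le h
      exact ⟨e, fun _ => he⟩
    · exact ⟨fun _ => ⊥, fun h' => absurd h' h⟩
  choose C hC using h1
  refine ⟨C, fun θ => ?_⟩
  obtain ⟨δ, ζ, h, hsub⟩ := hc θ
  exact ⟨(δ, ζ), (hC (δ, ζ) h).1, fun i => hsub ((hC (δ, ζ) h).2 i)⟩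

end ClubGuessing

/-! ### Groups with prescribed divisibility -/

section IntegralSubgroup

theorem prime_nth_prime (k : ℕ) : (Nat.nth Nat.Prime k).Prime :=
  Nat.nth_mem_of_infinite Nat.infinite_setOfPred_prime k

instance fact_prime_nth_prime (k : ℕ) : Fact (Nat.nth Nat.Prime k).Prime := ⟨prime_nth_prime k⟩

variable {X Z : Type*}

/-- The rational combinations of elements of `X` all of whose sums over a fibre of `c k` are
integral at the `k`-th prime. -/
noncomputable def integralSubgroup (c : ℕ → X → Z) : AddSubgroup (X →₀ ℚ) where
  carrier := {h | ∀ k z, padicNorm (Nat.nth Nat.Prime k) (h.mapDomain (c k) z) ≤ 1}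
  zero_mem' k z := by simp
  add_mem' {a b} ha hb k z := by
    rw [Finsupp.mapDomain_add, Finsupp.add_apply]
    exact padicNorm.nonarchimedean.trans (max_le (ha k z) (hb k z))
  neg_mem' {a} ha k z := by
    have : Finsupp.mapDomain (c k) (-a) = -Finsupp.mapDomain (c k) a :=
      map_neg (Finsupp.mapDomain.addMonoidHom (c k)) a
    rw [this, Finsupp.neg_apply, padicNorm.neg]
    exact ha k z

variable {c : ℕ → X → Z}

theorem padicNorm_pow (p : ℕ) [Fact p.Prime] (q : ℚ) (m : ℕ) :
    padicNorm p (q ^ m) = padicNorm p q ^ m := by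
  induction m with
  | zero => simp
  | succ m ih => rw [pow_succ, padicNorm.mul, ih, pow_succ]

theorem single_one_mem_integralSubgroup (w : X) :
    Finsupp.single w 1 ∈ integralSubgroup c := by
  classical
  intro k z
  rw [Finsupp.mapDomain_single, Finsupp.single_apply]
  split_ifs <;> simp

/-- The generator of `integralSubgroup c` at `w`. -/
noncomputable def integralSingle (c : ℕ → X → Z) (w : X) : integralSubgroup c :=
  ⟨Finsupp.single w 1, single_one_mem_integralSubgroup w⟩

theorem integralSingle_injective : Function.Injective (integralSingle c) := fun _ _ h =>
  Finsupp.single_left_injective (one_ne_zero (α := ℚ)) (congrArg Subtype.val h)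

/-- In the quotient by `p ^ m` the fibre sums at `k` cancel, and at every other prime the
coefficients are units. -/
theorem exists_nsmul_eq_integralSingle_sub {k : ℕ} {w w' : X} (h : c k w = c k w') (m : ℕ) :
    ∃ g, Nat.nth Nat.Prime k ^ m • g = integralSingle c w - integralSingle c w' := by
  classical
  have hp : (Nat.nth Nat.Prime k : ℚ) ≠ 0 := by exact_mod_cast (prime_nth_prime k).ne_zero
  set q : ℚ := ((Nat.nth Nat.Prime k : ℚ) ^ m)⁻¹ with hq
  refine ⟨⟨Finsupp.single w q - Finsupp.single w' q, fun k' z => ?_⟩, ?_⟩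
  · have hmap : Finsupp.mapDomain (c k') (Finsupp.single w q - Finsupp.single w' q) =
        Finsupp.single (c k' w) q - Finsupp.single (c k' w') q := by
      rw [← Finsupp.mapDomain_single, ← Finsupp.mapDomain_single]
      exact map_sub (Finsupp.mapDomain.addMonoidHom (c k')) _ _
    rw [hmap]
    by_cases hk : k' = k
    · subst hk
      simp [h]
    · have hne : Nat.nth Nat.Prime k' ≠ Nat.nth Nat.Prime k := fun e =>
        hk (Nat.nth_injective Nat.infinite_setOfPred_prime e)
      have hnorm : padicNorm (Nat.nth Nat.Prime k') q = 1 := by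
        rw [hq, ← one_div, padicNorm.div, padicNorm.one, padicNorm_pow,
          padicNorm.padicNorm_of_prime_of_ne hne, one_pow, div_one]
      rw [Finsupp.sub_apply]
      refine padicNorm.sub.trans (max_le ?_ ?_)
      all_goals
        rw [Finsupp.single_apply]
        split_ifs <;> simp [hnorm]
  · ext x
    simp [integralSingle, hq, mul_sub, Finsupp.single_apply, hp]

theorem mapDomain_eq_zero_of_forall_exists_nsmul {h : integralSubgroup c} {k : ℕ}
    (hh : ∀ m : ℕ, ∃ g, Nat.nth Nat.Prime k ^ m • g = h) : h.1.mapDomain (c k) = 0 := by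
  ext z
  set p := Nat.nth Nat.Prime k
  by_contra hne
  have hpos : 0 < padicNorm p (h.1.mapDomain (c k) z) :=
    lt_of_le_of_ne (padicNorm.nonneg _) (padicNorm.nonzero hne).symm
  have hp1 : ((p : ℚ))⁻¹ < 1 := inv_lt_one_of_one_lt₀ (by exact_mod_cast (prime_nth_prime k).one_lt)
  obtain ⟨m, hm⟩ := exists_pow_lt_of_lt_one hpos hp1
  obtain ⟨g, rfl⟩ := hh m
  have h1 : ((p ^ m • g : integralSubgroup c) : X →₀ ℚ).mapDomain (c k) =
      p ^ m • g.1.mapDomain (c k) :=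
    map_nsmul (Finsupp.mapDomain.addMonoidHom (c k)) (p ^ m) g.1
  rw [h1, Finsupp.smul_apply, nsmul_eq_mul, padicNorm.mul, Nat.cast_pow, padicNorm_pow,
    padicNorm.padicNorm_p_of_prime] at hm
  exact absurd hm (not_lt.2 (mul_le_of_le_one_right (by positivity) (g.2 k z)))

/-- The fibres of the maps `c k` separate a point from the rest of any finite set. -/
def SeparatesFinsets (c : ℕ → X → Z) : Prop :=
  ∀ S : Finset X, S.Nonempty → ∃ w ∈ S, ∃ k, ∀ w' ∈ S, c k w' = c k w → w' = w

/-- A separated point of the support is alone in its fibre, so its coefficient is a fibre sum. -/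
theorem eq_zero_of_mapDomain_eq_zero (hc : SeparatesFinsets c) {h : X →₀ ℚ}
    (hh : ∀ k, h.mapDomain (c k) = 0) : h = 0 := by
  classical
  by_contra hne
  obtain ⟨w, hw, k, hk⟩ := hc h.support (Finsupp.support_nonempty_iff.2 hne)
  have h1 := DFunLike.congr_fun (hh k) (c k w)
  rw [Finsupp.mapDomain, Finsupp.sum, Finsupp.finsetSum_apply,
    Finset.sum_eq_single_of_mem w hw] at h1
  · simp at h1
    exact Finsupp.mem_support_iff.1 hw h1
  · intro w' hw' hww'
    exact Finsupp.single_eq_of_ne fun e => hww' (hk w' hw' e.symm)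

theorem isReducedGroup_integralSubgroup {X : Type u} {c : ℕ → X → Z} (hc : SeparatesFinsets c) :
    AddCommGroup.IsReducedGroup (integralSubgroup c) := by
  rintro ⟨φ, hφ⟩
  have h0 : φ 1 = 0 := by
    refine Subtype.ext (eq_zero_of_mapDomain_eq_zero hc fun k =>
      mapDomain_eq_zero_of_forall_exists_nsmul fun m => ?_)
    have hp : (Nat.nth Nat.Prime k : ℚ) ≠ 0 := by exact_mod_cast (prime_nth_prime k).ne_zero
    refine ⟨φ (((Nat.nth Nat.Prime k : ℚ) ^ m)⁻¹), ?_⟩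
    rw [← map_nsmul]
    simp [hp]
  exact one_ne_zero (hφ (h0.trans (map_zero φ).symm))

theorem isReducedTorsionFreeOfCard_integralSubgroup {X : Type u} [Infinite X] {c : ℕ → X → Z}
    (hc : SeparatesFinsets c) : IsReducedTorsionFreeOfCard #X (integralSubgroup c) where
  torsionFree := inferInstance
  reduced := isReducedGroup_integralSubgroup hc
  card_eq := by
    refine le_antisymm ?_ (Cardinal.mk_le_of_injective (integralSingle_injective (c := c)))
    refine (Cardinal.mk_le_of_injective Subtype.val_injective).trans_eq ?_
    rw [Cardinal.mk_finsupp_lift_of_infinite]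
    simp

theorem exists_nsmul_eq_of_forall_prime_pow {G : Type u} [AddCommGroup G] {x : G}
    (hx : ∀ k m : ℕ, ∃ g, Nat.nth Nat.Prime k ^ m • g = x) {n : ℕ} (hn : n ≠ 0) :
    ∃ g, n • g = x := by
  induction n using Nat.recOnPrimeCoprime with
  | zero => exact absurd rfl hn
  | prime_pow p m hp =>
    obtain ⟨k, hk⟩ : ∃ k, Nat.nth Nat.Prime k = p := by
      have : p ∈ Set.range (Nat.nth Nat.Prime) := by
        rw [Nat.range_nth_of_infinite Nat.infinite_setOfPred_prime]; exact hp
      exact this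
    exact hk ▸ hx k m
  | coprime a b ha hb hab iha ihb =>
    obtain ⟨g, hg⟩ := iha (by omega)
    obtain ⟨g', hg'⟩ := ihb (by omega)
    have hbez : (1 : ℤ) = a * Nat.gcdA a b + b * Nat.gcdB a b := by
      rw [← Nat.gcd_eq_gcd_ab, hab, Nat.cast_one]
    refine ⟨Nat.gcdA a b • g' + Nat.gcdB a b • g, ?_⟩
    have h1 : ((a : ℤ) * Nat.gcdA a b) • (b • g') + ((b : ℤ) * Nat.gcdB a b) • (a • g) = x := by
      rw [hg, hg', ← add_smul, ← hbez, one_smul]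
    rw [← h1, ← natCast_zsmul, ← natCast_zsmul g', ← natCast_zsmul g, smul_add, smul_smul,
      smul_smul, smul_smul, smul_smul]
    push_cast
    congr 2 <;> ring

/-- In a reduced torsion-free group no nonzero element is divisible by all prime powers. -/
theorem eq_zero_of_forall_exists_prime_pow_nsmul {G : Type u} [AddCommGroup G]
    [IsAddTorsionFree G] (hG : AddCommGroup.IsReducedGroup G) {x : G}
    (hx : ∀ k m : ℕ, ∃ g, Nat.nth Nat.Prime k ^ m • g = x) : x = 0 := by
  by_contra hne
  -- Divisibility by every integer defines `q • x`; torsion-freeness makes it additive in `q`,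
  -- embedding ℚ.
  have h1 : ∀ q : ℚ, ∃ g, (q.den : ℤ) • g = q.num • x := by
    intro q
    obtain ⟨g, hg⟩ := exists_nsmul_eq_of_forall_prime_pow hx q.den_ne_zero
    exact ⟨q.num • g, by rw [smul_comm, natCast_zsmul, hg]⟩
  choose φ hφ using h1
  have hadd : ∀ q r, φ (q + r) = φ q + φ r := by
    intro q r
    have hd : ((q + r).den * (q.den * r.den) : ℤ) ≠ 0 := by
      exact_mod_cast mul_ne_zero (q + r).den_ne_zero (mul_ne_zero q.den_ne_zero r.den_ne_zero)
    refine zsmul_right_injective hd ?_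
    have e1 : ((q + r).den * (q.den * r.den) : ℤ) • φ (q + r) =
        ((q + r).num * q.den * r.den) • x := by
      rw [mul_comm, mul_smul, hφ, smul_smul]; congr 1; ring
    have e2 : ((q + r).den * (q.den * r.den) : ℤ) • φ q =
        ((q + r).den * r.den * q.num) • x := by
      rw [mul_comm (q.den : ℤ), ← mul_assoc, mul_smul, hφ, smul_smul]
    have e3 : ((q + r).den * (q.den * r.den) : ℤ) • φ r =
        ((q + r).den * q.den * r.num) • x := by
      rw [← mul_assoc, mul_smul, hφ, smul_smul]
    simp only [smul_add]
    rw [e1, e2, e3, ← add_smul, Rat.add_num_den' q r]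
    congr 1; ring
  refine hG ⟨AddMonoidHom.mk' φ hadd, (injective_iff_map_eq_zero _).2 fun q hq => ?_⟩
  have h2 := hφ q
  rw [show φ q = 0 from hq, smul_zero] at h2
  exact Rat.num_eq_zero.1 ((smul_eq_zero.1 h2.symm).resolve_right hne)

end IntegralSubgroup

/-! ### Paths of labels and bits -/

section Nodes

variable {Λ : Type u}

/-- A sequence of labels together with a sequence of bits, both possibly finite. -/
abbrev LabelledPath (Λ : Type u) : Type u := (ℕ → Option Λ) × (ℕ → Option Bool)

namespace LabelledPath

/-- The path with finitely many labels and bits. -/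
def ofLists (l : List Λ) (t : List Bool) : LabelledPath Λ := (fun n => l[n]?, fun n => t[n]?)

/-- The infinite path with the given labels and bits. -/
def ofSeqs (η : ℕ → Λ) (b : ℕ → Bool) : LabelledPath Λ := (fun n => some (η n), fun n => some (b n))

/-- The labels of a path up to the first place where its bits differ from those of `k`. -/
def agreement (k : ℕ) (w : LabelledPath Λ) (n : ℕ) : Option Λ :=
  open Classical in if ∀ j < n, w.2 j = some (k.testBit j) then w.1 n else none

/-- The finite paths with one more label than bits, and the infinite paths with labels in `Y`. -/
def nodes (Y : Set (ℕ → Λ)) : Set (LabelledPath Λ) :=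
  {w | (∃ l t, l.length = t.length + 1 ∧ w = ofLists l t) ∨ ∃ η ∈ Y, ∃ b, w = ofSeqs η b}

theorem ofLists_mem_nodes {Y : Set (ℕ → Λ)} {l : List Λ} {t : List Bool}
    (h : l.length = t.length + 1) : ofLists l t ∈ nodes Y := Or.inl ⟨l, t, h, rfl⟩

theorem ofSeqs_mem_nodes {Y : Set (ℕ → Λ)} {η : ℕ → Λ} (h : η ∈ Y) (b : ℕ → Bool) :
    ofSeqs η b ∈ nodes Y := Or.inr ⟨η, h, b, rfl⟩

theorem exists_length_of_mem_nodes {Y : Set (ℕ → Λ)} {w : LabelledPath Λ} (hw : w ∈ nodes Y) :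
    ∃ L : ℕ∞, ∀ n : ℕ, ((w.2 n).isSome ↔ (n : ℕ∞) < L) ∧ ((w.1 n).isSome ↔ (n : ℕ∞) ≤ L) := by
  obtain ⟨l, t, h, rfl⟩ | ⟨η, -, b, rfl⟩ := hw
  · refine ⟨t.length, fun n => ?_⟩
    simp [ofLists, h]
  · exact ⟨⊤, fun n => by simp [ofSeqs]⟩

theorem exists_forall_testBit_eq (M : ℕ) (f : ℕ → Bool) : ∃ k : ℕ, ∀ j < M, k.testBit j = f j :=
  ⟨Nat.ofBits fun i : Fin M => f i, fun j hj => Nat.testBit_ofBits_lt _ j hj⟩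

/-- Choose a longest path `w` in the set and let `k` follow its bits far enough. A path with the
same agreement shares these labels and bits; if `w` ends there, maximality makes the other path end
there too. -/
theorem separatesFinsets_agreement (Y : Set (ℕ → Λ)) :
    SeparatesFinsets fun k (w : nodes Y) => agreement k w.1 := by
  classical
  choose L hL using fun w : nodes Y => exists_length_of_mem_nodes w.2
  intro S hS
  obtain ⟨w, hw, hmax⟩ := S.exists_max_image L hS
  have hsep : ∀ w' : nodes Y, ∃ n, w' ≠ w → w'.1.1 n ≠ w.1.1 n ∨ w'.1.2 n ≠ w.1.2 n := by
    intro w'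
    by_contra! h
    obtain ⟨hne, -⟩ := h 0
    exact hne (Subtype.ext (Prod.ext (funext fun n => (h n).2.1) (funext fun n => (h n).2.2)))
  choose s hs using hsep
  obtain ⟨N, hN⟩ : ∃ N, ∀ w' ∈ S, s w' < N :=
    ⟨S.sup s + 1, fun w' hw' => Nat.lt_succ_of_le (Finset.le_sup hw')⟩
  obtain ⟨M, hM, hML⟩ : ∃ M : ℕ, (M : ℕ∞) ≤ L w ∧ (N ≤ M ∨ (M : ℕ∞) = L w) := by
    by_cases h : (N : ℕ∞) ≤ L w
    · exact ⟨N, h, Or.inl le_rfl⟩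
    · obtain ⟨M, hM⟩ := ENat.ne_top_iff_exists.1 (not_le.1 h).ne_top
      exact ⟨M, hM.le, Or.inr hM⟩
  obtain ⟨k, hk⟩ := exists_forall_testBit_eq M fun j => (w.1.2 j).getD false
  have hwk : ∀ j < M, w.1.2 j = some (k.testBit j) := by
    intro j hj
    have h1 := ((hL w j).1).2 (lt_of_lt_of_le (by exact_mod_cast hj) hM)
    rw [hk j hj]
    obtain ⟨e, he⟩ := Option.isSome_iff_exists.1 h1
    simp [he]
  refine ⟨w, hw, k, fun w' hw' heq => ?_⟩
  replace heq : agreement k w'.1 = agreement k w.1 := heq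
  have hwag : ∀ n ≤ M, agreement k w.1 n = w.1.1 n := fun n hn =>
    if_pos fun j hj => hwk j (hj.trans_le hn)
  have hw'k : ∀ j < M, w'.1.2 j = some (k.testBit j) := by
    by_contra hcon
    have h1 : agreement k w'.1 M = none := if_neg hcon
    rw [congrFun heq M, hwag M le_rfl] at h1
    have h2 := ((hL w M).2).2 hM
    simp [h1] at h2
  have hw'ag : ∀ n ≤ M, agreement k w'.1 n = w'.1.1 n := fun n hn =>
    if_pos fun j hj => hw'k j (hj.trans_le hn)
  have hfst : ∀ n ≤ M, w'.1.1 n = w.1.1 n := fun n hn => by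
    rw [← hw'ag n hn, ← hwag n hn, congrFun heq n]
  by_contra hne
  rcases hML with hNM | hML
  · have h1 := (hN w' hw').trans_le hNM
    exact (hs w' hne).elim (fun h => h (hfst _ h1.le))
      fun h => h ((hw'k _ h1).trans (hwk _ h1).symm)
  · have hL' : L w' = L w := by
      refine le_antisymm (hmax w' hw') (hML ▸ ?_)
      exact ((hL w' M).2).1 (by rw [hfst M le_rfl]; exact ((hL w M).2).2 hM)
    rcases hs w' hne with h | h
    · rcases le_or_gt (s w') M with h1 | h1
      · exact h (hfst _ h1)
      · have h2 : ¬ ((s w' : ℕ) : ℕ∞) ≤ L w := by rw [← hML]; exact_mod_cast h1.not_ge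
        have h3 := (not_congr (hL w (s w')).2).2 h2
        have h4 := (not_congr (hL w' (s w')).2).2 (hL' ▸ h2)
        rw [Option.not_isSome_iff_eq_none] at h3 h4
        exact h (h4.trans h3.symm)
    · rcases lt_or_ge (s w') M with h1 | h1
      · exact h ((hw'k _ h1).trans (hwk _ h1).symm)
      · have h2 : ¬ ((s w' : ℕ) : ℕ∞) < L w := by rw [← hML]; exact_mod_cast h1.not_gt
        have h3 := (not_congr (hL w (s w')).1).2 h2
        have h4 := (not_congr (hL w' (s w')).1).2 (hL' ▸ h2)
        rw [Option.not_isSome_iff_eq_none] at h3 h4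
        exact h (h4.trans h3.symm)

theorem mk_nodes [Infinite Λ] (hΛ : 2 ^ ℵ₀ ≤ #Λ) {Y : Set (ℕ → Λ)} (hY : #Y ≤ #Λ) :
    #(nodes Y) = #Λ := by
  have hω : ℵ₀ ≤ #Λ := Cardinal.aleph0_le_mk Λ
  refine le_antisymm ?_ ?_
  · have hsub : nodes Y ⊆ Set.range (fun p : List Λ × List Bool => ofLists p.1 p.2) ∪
        Set.range fun p : Y × (ℕ → Bool) => ofSeqs p.1.1 p.2 := by
      rintro w (⟨l, t, -, rfl⟩ | ⟨η, hη, b, rfl⟩)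
      · exact Or.inl ⟨(l, t), rfl⟩
      · exact Or.inr ⟨(⟨η, hη⟩, b), rfl⟩
    refine (Cardinal.mk_le_mk_of_subset hsub).trans ((Cardinal.mk_union_le _ _).trans ?_)
    refine Cardinal.add_le_of_le hω (Cardinal.mk_range_le.trans ?_)
      (Cardinal.mk_range_le.trans ?_)
    · simp [Cardinal.mk_list_eq_mk, hω, Cardinal.mul_aleph0_eq]
    · simp only [Cardinal.mk_prod, Cardinal.lift_uzero]
      refine (mul_le_mul' hY ?_).trans_eq (Cardinal.mul_eq_self hω)
      simpa using hΛ
  · refine Cardinal.mk_le_of_injective (f := fun a : Λ =>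
      (⟨ofLists [a] [], ofLists_mem_nodes rfl⟩ : nodes Y)) fun a b h => ?_
    have := congrFun (congrArg (fun w : nodes Y => w.1.1) h) 0
    simpa [ofLists] using this

/-- The bits of `k` differ from those of `t`. -/
def BitsDiffer (t : List Bool) (k : ℕ) : Prop := ∃ j, ∃ h : j < t.length, t[j] ≠ k.testBit j

theorem bitsDiffer_append (t : List Bool) (k : ℕ) :
    BitsDiffer (t ++ [false]) k ∨ BitsDiffer (t ++ [true]) k := by
  cases h : k.testBit t.length
  · exact Or.inr ⟨t.length, by simp, by simp [h]⟩
  · exact Or.inl ⟨t.length, by simp, by simp [h]⟩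

/-- Divergence from `k` at a bit `j ≤ n` hides all labels beyond `n`. The truncation keeps one label
more than bits, and its missing bit `n` counts as a divergence, so the case `j = n` is covered. -/
theorem agreement_ofSeqs (η : ℕ → Λ) (b : ℕ → Bool) {n k : ℕ}
    (hk : BitsDiffer ((List.range (n + 1)).map b) k) :
    agreement k (ofSeqs η b) =
      agreement k (ofLists ((List.range (n + 1)).map η) ((List.range n).map b)) := by
  obtain ⟨j, hj, hjk⟩ := hk
  simp only [List.length_map, List.length_range, List.getElem_map, List.getElem_range] at hj hjk
  funext m
  unfold agreement
  rcases le_or_gt m n with hm | hm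
  · have h1 : ∀ i < m, (ofLists ((List.range (n + 1)).map η) ((List.range n).map b)).2 i =
        (ofSeqs η b).2 i := by
      intro i hi
      simp [ofLists, ofSeqs, List.getElem?_range (hi.trans_le hm)]
    have h2 : (ofLists ((List.range (n + 1)).map η) ((List.range n).map b)).1 m =
        (ofSeqs η b).1 m := by
      simp [ofLists, ofSeqs, List.getElem?_range (Nat.lt_succ_of_le hm)]
    rw [h2]
    congr 1
    exact propext (forall₂_congr fun i hi => by rw [h1 i hi])
  · rw [if_neg, if_neg]
    · intro h
      have := h n hm
      simp [ofLists] at this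
    · intro h
      have := h j (by omega)
      simp [ofSeqs] at this
      exact hjk this

end LabelledPath

end Nodes

/-! ### Decoding sequences from group elements -/

section Decoding

open LabelledPath

variable {G : Type u} [AddCommGroup G]

/-- The difference is divisible by all powers of the primes whose bits differ from `t`. -/
def CongrOff (t : List Bool) (x y : G) : Prop :=
  ∀ k, BitsDiffer t k → ∀ m : ℕ, ∃ g, Nat.nth Nat.Prime k ^ m • g = x - y

theorem CongrOff.symm {t : List Bool} {x y : G} (h : CongrOff t x y) : CongrOff t y x := by
  intro k hk m
  obtain ⟨g, hg⟩ := h k hk m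
  exact ⟨-g, by rw [smul_neg, hg, neg_sub]⟩

theorem CongrOff.trans {t : List Bool} {x y z : G} (h : CongrOff t x y) (h' : CongrOff t y z) :
    CongrOff t x z := by
  intro k hk m
  obtain ⟨g, hg⟩ := h k hk m
  obtain ⟨g', hg'⟩ := h' k hk m
  exact ⟨g + g', by rw [smul_add, hg, hg', sub_add_sub_cancel]⟩

theorem eq_of_congrOff_append [IsAddTorsionFree G] (hG : AddCommGroup.IsReducedGroup G)
    {t : List Bool} {x x' : G} (h₀ : CongrOff (t ++ [false]) x x')
    (h₁ : CongrOff (t ++ [true]) x x') : x = x' :=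
  sub_eq_zero.1 <| eq_zero_of_forall_exists_prime_pow_nsmul hG fun k m =>
    (bitsDiffer_append t k).elim (fun h => h₀ k h m) fun h => h₁ k h m

/-- A sequence of bits built by choosing each bit according to the earlier ones. -/
theorem exists_bits {P : List Bool → Bool → Prop} (h : ∀ t, ∃ e, P t e) :
    ∃ b : ℕ → Bool, ∀ n, P ((List.range n).map b) (b n) := by
  choose e he using h
  let T : ℕ → List Bool := fun n => Nat.rec [] (fun _ t => t ++ [e t]) n
  have hT : ∀ n, (List.range n).map (fun n => e (T n)) = T n := by
    intro n
    induction n with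
    | zero => rfl
    | succ n ih => rw [List.range_succ, List.map_append, ih]; rfl
  exact ⟨fun n => e (T n), fun n => by rw [hT]; exact he _⟩

variable {Λ M : Type u} [LinearOrder Λ] [LinearOrder M]

/-- The element `y` determines `η`, given the filtration along `C` and the bits `b`. -/
def Decodes (r : G → Λ) (C : M → Λ) (y : G) (b : ℕ → Bool) (η : ℕ → M) : Prop :=
  ∀ n, (∀ i ≤ η n, ∀ g, r g < C i → ¬ CongrOff ((List.range (n + 1)).map b) y g) ∧
    ∀ i, η n < i → ∃ g, r g < C i ∧ CongrOff ((List.range (n + 1)).map b) y g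

theorem Decodes.unique {r : G → Λ} {C : M → Λ} {y : G} {b : ℕ → Bool} {η η' : ℕ → M}
    (h : Decodes r C y b η) (h' : Decodes r C y b η') : η = η' := by
  funext n
  rcases lt_trichotomy (η n) (η' n) with hlt | heq | hlt
  · obtain ⟨g, hg, hc⟩ := (h n).2 _ hlt
    exact absurd hc ((h' n).1 _ le_rfl g hg)
  · exact heq
  · obtain ⟨g, hg, hc⟩ := (h' n).2 _ hlt
    exact absurd hc ((h n).1 _ le_rfl g hg)

/-- Every final segment of `M` has full size, so an arbitrary sequence can be coded by successive
jumps upward. -/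
theorem mk_power_le_mk_strictMono (hM : ℵ₀ ≤ #M) (hIio : ∀ a : M, #(Set.Iio a) < #M) :
    #M ^ ℵ₀ ≤ #{η : ℕ → M // StrictMono η} := by
  have : Infinite M := Cardinal.infinite_iff.2 hM
  have h1 : ∀ a : M, ∃ h : M → M, Function.Injective h ∧ ∀ x, a < h x := by
    intro a
    have h2 : #(Set.Iic a) < #M := by
      have h : (Set.Iic a : Set M) = Set.Iio a ∪ {a} := by ext; simp [le_iff_lt_or_eq]
      rw [h]
      exact (Cardinal.mk_union_le _ _).trans_lt (Cardinal.add_lt_of_lt hM (hIio a)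
        (by simpa using Cardinal.one_lt_aleph0.trans_le hM))
    have h3 : #M ≤ #(Set.Iic a)ᶜ.Elem := (Cardinal.mk_compl_of_infinite _ h2).ge
    obtain ⟨f⟩ := Cardinal.le_def _ _ |>.1 h3
    exact ⟨fun x => (f x).1, fun x y h => f.injective (Subtype.ext h),
      fun x => not_le.1 (f x).2⟩
  choose h hinj hlt using h1
  obtain ⟨a₀⟩ : Nonempty M := inferInstance
  let F : (ℕ → M) → ℕ → M := fun ξ n => Nat.rec a₀ (fun n a => h a (ξ n)) n
  have hF : ∀ ξ n, F ξ (n + 1) = h (F ξ n) (ξ n) := fun _ _ => rfl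
  have hmono : ∀ ξ, StrictMono (F ξ) := fun ξ => strictMono_nat_of_lt_succ fun n => by
    rw [hF]; exact hlt _ _
  have hFinj : Function.Injective fun ξ => (⟨F ξ, hmono ξ⟩ : {η : ℕ → M // StrictMono η}) := by
    intro ξ ξ' heq
    have heq' : F ξ = F ξ' := congrArg Subtype.val heq
    funext n
    have h2 := congrFun heq' (n + 1)
    rw [hF, hF, congrFun heq' n] at h2
    exact hinj _ h2
  simpa using Cardinal.mk_le_of_injective hFinj

theorem exists_strictMono_forall_not_decodes {J : Type u} (r : G → Λ) (C : J → M → Λ)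
    (hM : ℵ₀ ≤ #M) (hIio : ∀ a : M, #(Set.Iio a) < #M) (hω : 2 ^ ℵ₀ ≤ #Λ) (hJ : #J ≤ #Λ)
    (hG : #G ≤ #Λ) (hΛ : #Λ < #M ^ ℵ₀) :
    ∃ η : ℕ → M, StrictMono η ∧ ∀ j y b, ¬ Decodes r (C j) y b η := by
  by_contra! hcon
  choose j y b hd using fun η : {η : ℕ → M // StrictMono η} => hcon η.1 η.2
  have hinj : Function.Injective fun η => (j η, y η, b η) := by
    intro η η' h
    simp only [Prod.mk.injEq] at h
    have h1 := hd η
    rw [h.1, h.2.1, h.2.2] at h1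
    exact Subtype.ext (h1.unique (hd η'))
  have hΛω : ℵ₀ ≤ #Λ := (Cardinal.cantor ℵ₀).le.trans hω
  refine ((mk_power_le_mk_strictMono hM hIio).trans (Cardinal.mk_le_of_injective hinj)).not_gt
    (lt_of_le_of_lt ?_ hΛ)
  simp only [Cardinal.mk_prod, Cardinal.lift_uzero]
  have hb : Cardinal.lift.{u} #(ℕ → Bool) ≤ #Λ := by simpa using hω
  calc _ ≤ #Λ * (#Λ * #Λ) := by simpa using mul_le_mul' hJ (mul_le_mul' hG (by simpa using hω))
    _ = #Λ := by rw [Cardinal.mul_eq_self hΛω, Cardinal.mul_eq_self hΛω]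

end Decoding

/-! ### Closed points and the blocking bits -/

section Coding

open LabelledPath

variable {Λ : Type u} [ConditionallyCompleteLinearOrderBot Λ]

theorem exists_lt_forall_mem_le {a : Λ} {l : List Λ} (hl : ∀ x ∈ l, x < a) {y : Λ} (hy : y < a) :
    ∃ b < a, y ≤ b ∧ ∀ x ∈ l, x ≤ b := by
  induction l with
  | nil => exact ⟨y, hy, le_rfl, by simp⟩
  | cons z l ih =>
    obtain ⟨b, hb, hyb, hlb⟩ := ih fun x hx => hl x (List.mem_cons_of_mem _ hx)
    refine ⟨max b z, max_lt hb (hl z (by simp)), hyb.trans (le_max_left _ _), fun x hx => ?_⟩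
    rcases List.mem_cons.1 hx with rfl | hx
    · exact le_max_right _ _
    · exact (hlb x hx).trans (le_max_left _ _)

theorem mk_list_Iic_prod_lt (hΛ : IsRegularUncountableOrder Λ) (a : Λ) :
    #(List (Set.Iic a) × List Bool) < #Λ := by
  have h1 : #(List (Set.Iic a)) < #Λ :=
    (Cardinal.mk_list_le_max _).trans_lt (max_lt hΛ.aleph0_lt (hΛ.mk_Iic_lt a))
  simp only [Cardinal.mk_prod, Cardinal.lift_uzero]
  refine Cardinal.mul_lt_of_lt hΛ.aleph0_lt.le h1 ?_
  simpa using hΛ.aleph0_lt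

variable {G : Type u} [AddCommGroup G] [IsAddTorsionFree G]

/-- Closed points reflect: below them there are no approximations to both sides of a new node. -/
theorem exists_closure_function (hΛ : IsRegularUncountableOrder Λ)
    (hG : AddCommGroup.IsReducedGroup G) (r : G ≃ Λ) (F : List Λ → List Bool → G)
    (hF : ∀ l t a a', l.length = t.length → F (l ++ [a]) t = F (l ++ [a']) t → a = a') :
    ∃ θ : Λ → Λ, (∀ β l t, (∀ x ∈ l, x ≤ β) → r (F l t) < θ β) ∧
      ∀ α ∈ closurePoints θ, ∀ l t, l.length = t.length → (∀ x ∈ l, x < α) →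
        ∃ e, ∀ g, r g < α → ¬ CongrOff (t ++ [e]) (F (l ++ [α]) t) g := by
  -- `u` recovers the last label from two approximations, one for each next bit.
  have h1 : ∀ (l : List Λ) (t : List Bool) (y₀ y₁ : Λ), ∃ u, ∀ a, l.length = t.length →
      CongrOff (t ++ [false]) (F (l ++ [a]) t) (r.symm y₀) →
      CongrOff (t ++ [true]) (F (l ++ [a]) t) (r.symm y₁) → a = u := by
    intro l t y₀ y₁
    by_cases h : ∃ a, CongrOff (t ++ [false]) (F (l ++ [a]) t) (r.symm y₀) ∧
      CongrOff (t ++ [true]) (F (l ++ [a]) t) (r.symm y₁)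
    · obtain ⟨u, h₀, h₁⟩ := h
      exact ⟨u, fun a hl ha₀ ha₁ => hF l t a u hl
        (eq_of_congrOff_append hG (ha₀.trans h₀.symm) (ha₁.trans h₁.symm))⟩
    · exact ⟨⊥, fun a _ ha₀ ha₁ => absurd ⟨a, ha₀, ha₁⟩ h⟩
  choose u hu using h1
  have h2 : ∀ β : Λ, ∃ v, (∀ l t, (∀ x ∈ l, x ≤ β) → r (F l t) < v) ∧
      ∀ l t y₀ y₁, (∀ x ∈ l, x ≤ β) → y₀ ≤ β → y₁ ≤ β → u l t y₀ y₁ < v := by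
    intro β
    have hlt := mk_list_Iic_prod_lt hΛ β
    obtain ⟨v₁, hv₁⟩ := hΛ.exists_gt_range
      (fun p : List (Set.Iic β) × List Bool => r (F (p.1.map Subtype.val) p.2))
      (by simpa using hlt)
    obtain ⟨v₂, hv₂⟩ := hΛ.exists_gt_range
      (fun p : (List (Set.Iic β) × List Bool) × (Set.Iic β × Set.Iic β) =>
        u (p.1.1.map Subtype.val) p.1.2 p.2.1 p.2.2)
      (by
        rw [Cardinal.lift_id, Cardinal.lift_id, ← Cardinal.mul_def, ← Cardinal.mul_def]
        exact Cardinal.mul_lt_of_lt hΛ.aleph0_lt.le hlt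
          (Cardinal.mul_lt_of_lt hΛ.aleph0_lt.le (hΛ.mk_Iic_lt β) (hΛ.mk_Iic_lt β)))
    refine ⟨max v₁ v₂, fun l t hl => ?_, fun l t y₀ y₁ hl h₀ h₁ => ?_⟩
    · lift l to List (Set.Iic β) using hl
      exact (hv₁ (l, t)).trans_le (le_max_left _ _)
    · lift l to List (Set.Iic β) using hl
      exact (hv₂ ((l, t), ⟨y₀, h₀⟩, ⟨y₁, h₁⟩)).trans_le (le_max_right _ _)
  choose θ hθF hθu using h2
  refine ⟨θ, hθF, fun α hα l t hlt hl => ?_⟩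
  by_contra! hcon
  obtain ⟨g₀, hg₀, hc₀⟩ := hcon false
  -- With approximations of rank below α on both sides, α is a value of `u` at data bounded by some
  -- `β < α`, so α < `θ β` < α.
  obtain ⟨g₁, hg₁, hc₁⟩ := hcon true
  obtain ⟨β, hβ, hyβ, hlβ⟩ := exists_lt_forall_mem_le hl (max_lt hg₀ hg₁)
  have h3 := hu l t (r g₀) (r g₁) α hlt (by simpa using hc₀) (by simpa using hc₁)
  have h4 := hθu β l t (r g₀) (r g₁) hlβ ((le_max_left _ _).trans hyβ)
    ((le_max_right _ _).trans hyβ)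
  exact (h4.trans (hα β hβ)).ne h3.symm

theorem exists_decodes (hΛ : IsRegularUncountableOrder Λ) (hG : AddCommGroup.IsReducedGroup G)
    (r : G ≃ Λ) {J M : Type u} [LinearOrder M] {C : J → M → Λ}
    (hC : ∀ θ : Λ → Λ, ∃ j, StrictMono (C j) ∧ ∀ i, C j i ∈ closurePoints θ)
    {η : ℕ → M} (hη : StrictMono η) {Y : Set (ℕ → Λ)} (hY : ∀ j, C j ∘ η ∈ Y)
    (f : nodes Y → G) (hf : Function.Injective f)
    (hfdiv : ∀ w w' k, agreement k w.1 = agreement k w'.1 →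
      ∀ m : ℕ, ∃ g, Nat.nth Nat.Prime k ^ m • g = f w - f w') :
    ∃ j y b, Decodes r (C j) y b η := by
  classical
  let F : List Λ → List Bool → G := fun l t =>
    if h : l.length = t.length + 1 then f ⟨ofLists l t, ofLists_mem_nodes h⟩ else 0
  have hFeq : ∀ l t (h : l.length = t.length + 1), F l t = f ⟨ofLists l t, ofLists_mem_nodes h⟩ :=
    fun l t h => dif_pos h
  have hF : ∀ l t a a', l.length = t.length → F (l ++ [a]) t = F (l ++ [a']) t → a = a' := by
    intro l t a a' hlt heq
    rw [hFeq _ _ (by simp [hlt]), hFeq _ _ (by simp [hlt])] at heq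
    have h1 := congrFun (congrArg (fun w : nodes Y => w.1.1) (hf heq)) l.length
    simpa [ofLists] using h1
  obtain ⟨θ, hθF, hθ⟩ := exists_closure_function hΛ hG r F hF
  obtain ⟨j, hj, hjθ⟩ := hC θ
  have hbelow : ∀ n, ∀ x ∈ (List.range n).map (C j ∘ η), x < C j (η n) := by
    intro n x hx
    obtain ⟨i, hi, rfl⟩ := List.mem_map.1 hx
    exact hj (hη (List.mem_range.1 hi))
  -- Each bit is chosen to block every approximation of rank below `C j (η n)` to the current
  -- truncation.
  obtain ⟨b, hb⟩ := exists_bits (P := fun t e => ∀ g, r g < C j (η t.length) →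
      ¬ CongrOff (t ++ [e]) (F ((List.range (t.length + 1)).map (C j ∘ η)) t) g) fun t => by
    rw [List.range_succ, List.map_append]
    exact hθ _ (hjθ _) _ t (by simp) (hbelow _)
  refine ⟨j, f ⟨ofSeqs (C j ∘ η) b, ofSeqs_mem_nodes (hY j) b⟩, b, fun n => ?_⟩
  have hn := hb n
  simp only [List.length_map, List.length_range] at hn
  rw [show (List.range n).map b ++ [b n] = (List.range (n + 1)).map b by
    rw [List.range_succ, List.map_append]; rfl] at hn
  have hlen : ((List.range (n + 1)).map (C j ∘ η)).length = ((List.range n).map b).length + 1 := by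
    simp
  have hclose : CongrOff ((List.range (n + 1)).map b)
      (f ⟨ofSeqs (C j ∘ η) b, ofSeqs_mem_nodes (hY j) b⟩)
      (F ((List.range (n + 1)).map (C j ∘ η)) ((List.range n).map b)) := by
    intro k hk
    rw [hFeq _ _ hlen]
    exact hfdiv _ _ k (agreement_ofSeqs _ _ hk)
  -- An approximation of rank below `C j i` with `i ≤ η n` would also approximate the truncation,
  -- which is blocked. For `i > η n` the truncation itself serves: its labels are at most `C j (η
  -- n)`, and `C j i` is closed under `θ`.
  refine ⟨fun i hi g hg hc => ?_, fun i hi => ⟨_, ?_, hclose⟩⟩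
  · exact hn g (hg.trans_le (hj.monotone hi)) (hclose.symm.trans hc)
  · refine (hθF (C j (η n)) _ _ fun x hx => ?_).trans (hjθ i _ (hj hi))
    obtain ⟨i', hi', rfl⟩ := List.mem_map.1 hx
    exact hj.monotone (hη.monotone (Nat.lt_succ_iff.1 (List.mem_range.1 hi')))

end Coding

/-! ### No universal group -/

theorem not_isUniversalReducedTorsionFree {Λ K : Type u} [ConditionallyCompleteLinearOrderBot Λ]
    [WellFoundedLT Λ] [LinearOrder K] [WellFoundedLT K] (hΛ : IsRegularUncountableOrder Λ)
    (hK : IsRegularUncountableOrder K) {μ : Cardinal.{u}} (hμ : 2 ^ ℵ₀ ≤ μ)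
    (hμK : #K = Order.succ μ) (hKΛ : #K < #Λ) (hΛμ : #Λ < μ ^ ℵ₀) (G : Type u) [AddCommGroup G] :
    ¬ IsUniversalReducedTorsionFree #Λ G := by
  intro hG
  have := hG.mem.torsionFree
  have : Infinite Λ := Cardinal.infinite_iff.2 hΛ.aleph0_lt.le
  have hμω : ℵ₀ ≤ μ := (Cardinal.cantor ℵ₀).le.trans hμ
  have hω : 2 ^ ℵ₀ ≤ #Λ := hμ.trans ((Order.le_succ μ).trans (hμK ▸ hKΛ.le))
  obtain ⟨r⟩ : Nonempty (G ≃ Λ) := Cardinal.eq.1 hG.mem.card_eq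
  obtain ⟨C, hC⟩ := exists_strictMono_guessing hΛ hK hμK hKΛ
  have hJ : #(Λ × K) ≤ #Λ := by
    rw [← Cardinal.mul_def]
    exact (mul_le_mul' le_rfl hKΛ.le).trans_eq (Cardinal.mul_eq_self hΛ.aleph0_lt.le)
  obtain ⟨η, hη, hund⟩ := exists_strictMono_forall_not_decodes r C (by simpa using hμω)
    (fun a => by simpa using Cardinal.mk_Iio_lt a) hω hJ hG.mem.card_eq.le (by simpa using hΛμ)
  -- The guessing index is known only once the embedding is given, so `η` is copied along every `C
  -- j`.
  let Y : Set (ℕ → Λ) := Set.range fun j => C j ∘ η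
  have hnodes : #(LabelledPath.nodes Y) = #Λ :=
    LabelledPath.mk_nodes hω (Cardinal.mk_range_le.trans hJ)
  have : Infinite (LabelledPath.nodes Y) := Cardinal.infinite_iff.2 (hnodes ▸ hΛ.aleph0_lt.le)
  let c : ℕ → LabelledPath.nodes Y → ℕ → Option Λ := fun k w => LabelledPath.agreement k w.1
  obtain ⟨f, hf⟩ := hG.embeds (integralSubgroup c) (hnodes ▸
    isReducedTorsionFreeOfCard_integralSubgroup (LabelledPath.separatesFinsets_agreement Y))
  obtain ⟨j, y, b, h⟩ := exists_decodes hΛ hG.mem.reduced r hC hη (Y := Y)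
    (fun j => ⟨j, rfl⟩) (fun w => f (integralSingle c w)) (hf.comp integralSingle_injective) fun w w' k hww' m => by
      obtain ⟨g, hg⟩ := exists_nsmul_eq_integralSingle_sub (c := c) hww' m
      exact ⟨f g, by rw [← map_nsmul, hg, map_sub]⟩
  exact hund j y b h

theorem mainTheorem1 (mu lam : Cardinal.{u})
    (h_continuum : 2 ^ ℵ₀ < Order.succ mu) (h_succ : Order.succ mu < lam)
    (h_regular : lam = lam.ord.cof) (h_power : lam < mu ^ ℵ₀) :
    ¬ ∃ (G : Type u) (_ : AddCommGroup G), IsUniversalReducedTorsionFree lam G := by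
  rintro ⟨G, _, hG⟩
  have hmu : 2 ^ ℵ₀ ≤ mu := Order.lt_succ_iff.1 h_continuum
  have hmuω : ℵ₀ < Order.succ mu := (Cardinal.cantor ℵ₀).trans h_continuum
  have hlam : ℵ₀ < lam := hmuω.trans h_succ
  have hΛ := isRegularUncountableOrder_ord_toType ⟨hlam.le, h_regular.le⟩ hlam
  have hK := isRegularUncountableOrder_ord_toType
    (Cardinal.isRegular_succ ((Cardinal.cantor ℵ₀).le.trans hmu)) hmuω
  have hmk : #lam.ord.ToType = lam := Cardinal.mk_ord_toType lam
  have : Nonempty lam.ord.ToType :=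
    Cardinal.mk_ne_zero_iff.1 (by rw [hmk]; exact (Cardinal.aleph0_pos.trans hlam).ne')
  let := WellFoundedLT.toOrderBot lam.ord.ToType
  let := WellFoundedLT.conditionallyCompleteLinearOrderBot lam.ord.ToType
  exact not_isUniversalReducedTorsionFree hΛ hK hmu (Cardinal.mk_ord_toType _)
    (by simpa using h_succ) (by simpa using h_power) G (hmk.symm ▸ hG)
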